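/- Let $\mathscr{H}$ be a complex Hilbert space. For $0<p<\infty$ let $\mathbb{B}_p(\mathscr{H})$ be the set of compact operators $X$ on $\mathscr{H}$ with $\|X\|_p:=\big(\sum_j s_j(X)^p\big)^{1/p}<\infty$, where the $s_j(X)$ are the singular values of $X$, that is, the nonzero eigenvalues of $|X|=(X^*X)^{1/2}$ counted with multiplicity. Let $0<p<\infty$ and $A,B\in\mathbb{B}_p(\mathscr{H})$. Then $A+B$ and $A-B$ belong to $\mathbb{B}_p(\mathscr{H})$. If $p\ge 2$, then $$2^{2-\frac p2}\big(\|A\|_p^2+\|B\|_p^2\big)^{\frac p2}\le\|A+B\|_p^p+\|A-B\|_p^p,$$ equivalently, $$2^{\frac 2p-1}\big(\|A\|_p^2+\|B\|_p^2\big)\le\left(\frac{\|A+B\|_p^p+\|A-B\|_p^p}{2}\right)^{\frac 2p}.$$ If $0<p\le 2$, both inequalities hold with $\le$ replaced by $\ge$. -/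

import Mathlib

noncomputable section

namespace Schatten

variable {H : Type*} [NormedAddCommGroup H] [InnerProductSpace ℂ H] [CompleteSpace H]

/-- The multiplicity of `s > 0` as a singular value of `X`, i.e. as an eigenvalue of
`|X| = (X* X)^{1/2}`: the dimension of the eigenspace of `X* X` at `s ^ 2`.
It is finite for every `s > 0` when `X` is compact. -/
def singularMultiplicity (X : H →L[ℂ] H) (s : ℝ) : ℕ :=
  Module.finrank ℂ (Module.End.eigenspace
    ((ContinuousLinearMap.adjoint X ∘L X : H →L[ℂ] H) : H →ₗ[ℂ] H) ((s : ℂ) ^ 2))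

/-- An index set for the nonzero singular values of a compact operator `X`, each repeated
according to its multiplicity. -/
abbrev Index (X : H →L[ℂ] H) : Type :=
  Σ s : Set.Ioi (0 : ℝ), Fin (singularMultiplicity X s)

/-- The singular value `s_j(X)`. The family `s_j(X)`, `j : Index X`, lists the nonzero singular
values of the compact operator `X` with multiplicity. -/
def singularValue (X : H →L[ℂ] H) (j : Index X) : ℝ := (j.1 : ℝ)

/-- `X` is in the Schatten class `B_p(H)`: it is compact and `∑ j, s_j(X) ^ p < ∞`. -/
def Mem (p : ℝ) (X : H →L[ℂ] H) : Prop :=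
  IsCompactOperator X ∧ Summable fun j : Index X => singularValue X j ^ p

/-- The Schatten (quasi-)norm `‖X‖_p = (∑ j, s_j(X) ^ p) ^ (1 / p)`, for `X` in `B_p(H)`. -/
def schattenNorm (p : ℝ) (X : H →L[ℂ] H) : ℝ :=
  (∑' j : Index X, singularValue X j ^ p) ^ (1 / p)

end Schatten

end

/-!
Everything is expressed through `tr |X| ^ p`, the sum of the `p`-th powers of the singular values,
and proved as an inequality in `[0, ∞]`, so that membership in the Schatten class comes for free.

If `b` is a Hilbert basis of right singular vectors of `X`, then `tr |X| ^ p = ∑ i, ‖X (b i)‖ ^ p`.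
For another Hilbert basis `c`, each `‖X (c k)‖ ^ 2` is the average of the numbers `‖X (b i)‖ ^ 2`
with the doubly stochastic weights `|⟪b i, c k⟫| ^ 2`, so Jensen's inequality for `t ↦ t ^ (p / 2)`
compares `∑ k, ‖X (c k)‖ ^ p` with `tr |X| ^ p`: it is at most `tr |X| ^ p` if `2 ≤ p`, and at least
`tr |X| ^ p` if `p ≤ 2`.

Let `C x = (A x, B x)`. Its adjoint restricts to `A†` and `B†` on the two summands, so comparing
in the union of singular bases of `A†` and `B†` gives `tr |A| ^ p + tr |B| ^ p ≤ tr |C| ^ p` for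
`2 ≤ p`. On the other hand `‖(A + B) x‖ ^ 2 + ‖(A - B) x‖ ^ 2 = ‖√2 C x‖ ^ 2` by the parallelogram
law, and comparing in a singular basis of `C` bounds `tr |√2 C| ^ p` by
`2 ^ (p / 2 - 1) * (tr |A + B| ^ p + tr |A - B| ^ p)`. Together these are the Clarkson–McCarthy
inequality `2 * (tr |A| ^ p + tr |B| ^ p) ≤ tr |A + B| ^ p + tr |A - B| ^ p`, from which the power
mean inequality for `‖A‖_p ^ 2` and `‖B‖_p ^ 2` finishes. For `p ≤ 2` every step is reversed.
-/

open scoped ENNReal NNReal InnerProductSpace InnerProduct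
open Module Submodule

theorem rpow_tsum_mul_le_tsum_mul_rpow {κ : Type*} {q : ℝ} (hq : 1 ≤ q) {w : κ → ℝ≥0∞}
    (hw : ∑' k, w k ≤ 1) (f : κ → ℝ≥0∞) : (∑' k, w k * f k) ^ q ≤ ∑' k, w k * f k ^ q := by
  have hq0 : 0 < q := by linarith
  have hexp : 0 ≤ 1 - q⁻¹ := sub_nonneg.2 (inv_le_one_of_one_le₀ hq)
  rw [← ENNReal.le_rpow_inv_iff hq0, ENNReal.tsum_eq_iSup_sum]
  refine iSup_le fun s => ?_
  calc ∑ k ∈ s, w k * f k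
      ≤ (∑ k ∈ s, w k) ^ (1 - q⁻¹) * (∑ k ∈ s, w k * f k ^ q) ^ q⁻¹ :=
        ENNReal.inner_le_weight_mul_Lp_of_nonneg s hq w f
    _ ≤ 1 * (∑' k, w k * f k ^ q) ^ q⁻¹ := by
        gcongr
        · exact ENNReal.rpow_le_one ((ENNReal.sum_le_tsum s).trans hw) hexp
        · exact ENNReal.sum_le_tsum s
    _ = (∑' k, w k * f k ^ q) ^ q⁻¹ := one_mul _

theorem tsum_mul_rpow_le_rpow_tsum_mul {κ : Type*} {q : ℝ} (hq0 : 0 < q) (hq1 : q ≤ 1)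
    {w : κ → ℝ≥0∞} (hw : ∑' k, w k ≤ 1) (f : κ → ℝ≥0∞) :
    ∑' k, w k * f k ^ q ≤ (∑' k, w k * f k) ^ q := by
  have h := rpow_tsum_mul_le_tsum_mul_rpow ((one_le_inv₀ hq0).2 hq1) hw fun k => f k ^ q
  simp only [ENNReal.rpow_rpow_inv hq0.ne'] at h
  exact (ENNReal.rpow_inv_le_iff hq0).1 h

theorem rpow_add_rpow_le_two_rpow_mul_add_rpow {q : ℝ} (hq0 : 0 < q) (hq1 : q ≤ 1)
    (a b : ℝ≥0∞) : a ^ q + b ^ q ≤ 2 ^ (1 - q) * (a + b) ^ q := by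
  have h := ENNReal.rpow_add_le_mul_rpow_add_rpow (a ^ q) (b ^ q) ((one_le_inv₀ hq0).2 hq1)
  rwa [ENNReal.rpow_rpow_inv hq0.ne', ENNReal.rpow_rpow_inv hq0.ne',
    ENNReal.rpow_inv_le_iff hq0, ENNReal.mul_rpow_of_nonneg _ _ hq0.le, ← ENNReal.rpow_mul,
    sub_mul, inv_mul_cancel₀ hq0.ne', one_mul] at h

section PowerMean

variable {a b p : ℝ}

theorem sq_rpow_half (ha : 0 ≤ a) : (a ^ 2) ^ (p / 2) = a ^ p := by
  rw [← Real.rpow_natCast, ← Real.rpow_mul ha, Nat.cast_ofNat, mul_div_cancel₀ p two_ne_zero]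

theorem two_rpow_two_sub (q : ℝ) : (2 : ℝ) ^ (2 - q) = 4 * (1 / 2) ^ q := by
  rw [Real.rpow_sub two_pos, Real.div_rpow zero_le_one zero_le_two, Real.one_rpow, Real.rpow_two]
  ring

theorem two_rpow_mul_add_sq_rpow_le (hp : 2 ≤ p) (ha : 0 ≤ a) (hb : 0 ≤ b) :
    2 ^ (2 - p / 2) * (a ^ 2 + b ^ 2) ^ (p / 2) ≤ 2 * (a ^ p + b ^ p) := by
  have hmean := (convexOn_rpow (by linarith : 1 ≤ p / 2)).2 (sq_nonneg a) (sq_nonneg b)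
    one_half_pos.le one_half_pos.le (add_halves 1)
  simp only [smul_eq_mul, ← mul_add, sq_rpow_half, ha, hb] at hmean
  rw [Real.mul_rpow one_half_pos.le (by positivity)] at hmean
  rw [two_rpow_two_sub]
  linarith

theorem two_mul_rpow_add_rpow_le (hp : 0 < p) (hp2 : p ≤ 2) (ha : 0 ≤ a) (hb : 0 ≤ b) :
    2 * (a ^ p + b ^ p) ≤ 2 ^ (2 - p / 2) * (a ^ 2 + b ^ 2) ^ (p / 2) := by
  have hmean := (Real.concaveOn_rpow (half_pos hp).le (by linarith)).2 (sq_nonneg a) (sq_nonneg b)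
    one_half_pos.le one_half_pos.le (add_halves 1)
  simp only [smul_eq_mul, ← mul_add, sq_rpow_half, ha, hb] at hmean
  rw [Real.mul_rpow one_half_pos.le (by positivity)] at hmean
  rw [two_rpow_two_sub]
  linarith

theorem two_rpow_mul_eq_rpow {N : ℝ} (hp : 0 < p) (hN : 0 ≤ N) :
    2 ^ (2 / p - 1) * N = (2 ^ (2 - p / 2) * N ^ (p / 2) / 2) ^ (2 / p) := by
  have hbase : (2 : ℝ) ^ (2 - p / 2) / 2 = 2 ^ (1 - p / 2) := by
    rw [← Real.rpow_sub_one two_ne_zero]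
    ring_nf
  rw [mul_div_right_comm, hbase, Real.mul_rpow (by positivity) (by positivity), ← Real.rpow_mul hN,
    ← Real.rpow_mul zero_le_two, sub_mul, div_mul_div_cancel₀ two_ne_zero, div_self hp.ne',
    one_mul, Real.rpow_one]

end PowerMean

theorem finrank_eigenspace_comp_comm {K V W : Type*} [Field K] [AddCommGroup V] [Module K V]
    [AddCommGroup W] [Module K W] (S : V →ₗ[K] W) (T : W →ₗ[K] V) {μ : K} (hμ : μ ≠ 0) :
    finrank K (End.eigenspace (T ∘ₗ S) μ) = finrank K (End.eigenspace (S ∘ₗ T) μ) := by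
  have hS : ∀ x ∈ End.eigenspace (T ∘ₗ S) μ, S x ∈ End.eigenspace (S ∘ₗ T) μ := by
    intro x hx
    rw [End.mem_eigenspace_iff, LinearMap.comp_apply] at hx ⊢
    rw [hx, map_smul]
  refine (LinearEquiv.ofBijective (S.restrict hS) ⟨?_, ?_⟩).finrank_eq
  · rw [injective_iff_map_eq_zero]
    rintro ⟨x, hx⟩ hSx
    have hSx : S x = 0 := congrArg Subtype.val hSx
    rw [End.mem_eigenspace_iff, LinearMap.comp_apply, hSx, map_zero] at hx
    exact Subtype.ext ((smul_eq_zero_iff_right hμ).1 hx.symm)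
  · rintro ⟨y, hy⟩
    rw [End.mem_eigenspace_iff, LinearMap.comp_apply] at hy
    refine ⟨⟨μ⁻¹ • T y, ?_⟩, Subtype.ext ?_⟩
    · rw [End.mem_eigenspace_iff, LinearMap.comp_apply, map_smul, map_smul, hy, map_smul,
        smul_comm]
    · rw [LinearMap.coe_restrict_apply, map_smul, hy, inv_smul_smul₀ hμ]

section HilbertBasis

variable {𝕜 E F G : Type*} [RCLike 𝕜] [NormedAddCommGroup E] [InnerProductSpace 𝕜 E]
  [NormedAddCommGroup F] [InnerProductSpace 𝕜 F] [NormedAddCommGroup G] [InnerProductSpace 𝕜 G]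
  {ι κ : Type*}

theorem eq_of_forall_inner_hilbertBasis_eq (b : HilbertBasis ι 𝕜 E) {x y : E}
    (h : ∀ i, ⟪b i, x⟫_𝕜 = ⟪b i, y⟫_𝕜) : x = y :=
  b.repr.injective <| lp.ext <| funext fun i => by
    rw [b.repr_apply_apply, b.repr_apply_apply, h]

theorem tsum_enorm_inner_sq (b : HilbertBasis ι 𝕜 E) (x : E) :
    ∑' i, ‖⟪b i, x⟫_𝕜‖ₑ ^ 2 = ‖x‖ₑ ^ 2 := by
  have h : HasSum (fun i => ‖⟪b i, x⟫_𝕜‖ ^ 2) (‖x‖ ^ 2) := by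
    simpa only [inner_mul_symm_re_eq_norm, norm_mul, norm_inner_symm x, ← sq,
      inner_self_eq_norm_sq] using! RCLike.hasSum_re 𝕜 (b.hasSum_inner_mul_inner x x)
  simp only [← ofReal_norm, ← ENNReal.ofReal_pow (norm_nonneg _), ← h.tsum_eq]
  exact (ENNReal.ofReal_tsum_of_nonneg (fun i => sq_nonneg _) h.summable).symm

theorem tsum_enorm_inner_sq_hilbertBasis (b : HilbertBasis ι 𝕜 E) (c : HilbertBasis κ 𝕜 E)
    (k : κ) : ∑' i, ‖⟪b i, c k⟫_𝕜‖ₑ ^ 2 = 1 := by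
  rw [tsum_enorm_inner_sq, ← ofReal_norm, c.orthonormal.norm_eq_one, ENNReal.ofReal_one, one_pow]

theorem tsum_tsum_enorm_inner_sq_mul (b : HilbertBasis ι 𝕜 E) (c : HilbertBasis κ 𝕜 E)
    (f : ι → ℝ≥0∞) : ∑' k, ∑' i, ‖⟪b i, c k⟫_𝕜‖ₑ ^ 2 * f i = ∑' i, f i := by
  have hswap (i : ι) (k : κ) : ‖⟪b i, c k⟫_𝕜‖ₑ = ‖⟪c k, b i⟫_𝕜‖ₑ := by
    rw [← ofReal_norm, norm_inner_symm, ofReal_norm]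
  rw [ENNReal.tsum_comm]
  simp only [hswap, ENNReal.tsum_mul_right, tsum_enorm_inner_sq_hilbertBasis c b, one_mul]

theorem orthonormal_sumElim_toLp {v : ι → F} {w : κ → G} (hv : Orthonormal 𝕜 v)
    (hw : Orthonormal 𝕜 w) :
    Orthonormal 𝕜 (Sum.elim (fun i => WithLp.toLp 2 (v i, 0)) fun j => WithLp.toLp 2 (0, w j) :
      ι ⊕ κ → WithLp 2 (F × G)) := by
  classical
  rw [orthonormal_iff_ite] at hv hw ⊢
  rintro (i | i) (j | j) <;>
    simp [WithLp.prod_inner_apply, hv, hw]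

theorem exists_hilbertBasis_prod [CompleteSpace F] [CompleteSpace G] (e : HilbertBasis ι 𝕜 F)
    (f : HilbertBasis κ 𝕜 G) :
    ∃ b : HilbertBasis (ι ⊕ κ) 𝕜 (WithLp 2 (F × G)),
      (∀ i, b (.inl i) = WithLp.toLp 2 (e i, 0)) ∧ ∀ j, b (.inr j) = WithLp.toLp 2 (0, f j) := by
  have hv := orthonormal_sumElim_toLp e.orthonormal f.orthonormal
  have hspan : (span 𝕜 (Set.range (Sum.elim (fun i => WithLp.toLp 2 (e i, 0))
      fun j => WithLp.toLp 2 (0, f j) : ι ⊕ κ → WithLp 2 (F × G))))ᗮ = ⊥ := by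
    rw [eq_bot_iff]
    intro z hz
    rw [mem_orthogonal] at hz
    have hfst : z.fst = 0 := eq_of_forall_inner_hilbertBasis_eq e fun i => by
      simpa [WithLp.prod_inner_apply] using hz _ (subset_span ⟨.inl i, rfl⟩)
    have hsnd : z.snd = 0 := eq_of_forall_inner_hilbertBasis_eq f fun j => by
      simpa [WithLp.prod_inner_apply] using hz _ (subset_span ⟨.inr j, rfl⟩)
    rw [mem_bot]
    exact congrArg (WithLp.toLp 2) (Prod.ext hfst hsnd)
  exact ⟨HilbertBasis.mkOfOrthogonalEqBot hv hspan, fun i => by simp, fun j => by simp⟩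

variable [CompleteSpace E]

theorem exists_hilbertBasis_mem_eigenspace {T : E →L[𝕜] E} (hc : IsCompactOperator T)
    (hT : (T : E →ₗ[𝕜] E).IsSymmetric) :
    ∃ (s : Set E) (b : HilbertBasis s 𝕜 E),
      ∀ i, ∃ μ : 𝕜, b i ∈ End.eigenspace (T : E →ₗ[𝕜] E) μ := by
  choose s c _ using fun μ : 𝕜 => exists_hilbertBasis 𝕜 (End.eigenspace (T : E →ₗ[𝕜] E) μ)
  let v (i : Σ μ, s μ) : E := c i.1 i.2
  have hv : Orthonormal 𝕜 v :=
    hT.orthogonalFamily_eigenspaces.orthonormal_sigma_orthonormal fun μ => (c μ).orthonormal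
  have hspan : (span 𝕜 (Set.range v))ᗮ = ⊥ := by
    rw [eq_bot_iff, ← ContinuousLinearMap.orthogonalComplement_iSup_eigenspaces_eq_bot hc hT,
      ← iInf_orthogonal]
    refine fun x hx => mem_iInf _ |>.2 fun μ => (mem_orthogonal' _ _).2 fun y hy => ?_
    have hsum := ((c μ).hasSum_repr ⟨y, hy⟩).mapL
      (innerSL 𝕜 x ∘L (End.eigenspace (T : E →ₗ[𝕜] E) μ).subtypeL)
    have hzero (i : s μ) : ⟪x, c μ i⟫_𝕜 = 0 :=
      (mem_orthogonal' _ _).1 hx _ (subset_span ⟨⟨μ, i⟩, rfl⟩)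
    simp only [map_smul, ContinuousLinearMap.comp_apply, coe_subtypeL, subtype_apply,
      coe_innerSL_apply, hzero, smul_eq_mul, mul_zero] at hsum
    exact hsum.unique hasSum_zero
  refine ⟨Set.range v, HilbertBasis.mkOfOrthogonalEqBot (v := ((↑) : Set.range v → E))
    hv.toSubtypeRange (by rwa [Subtype.range_coe]), ?_⟩
  rintro ⟨_, ⟨μ, i⟩, rfl⟩
  exact ⟨μ, by simp [v]⟩

end HilbertBasis

namespace Schatten

variable {𝕜 E F G : Type*} [RCLike 𝕜] [NormedAddCommGroup E] [InnerProductSpace 𝕜 E]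
  [NormedAddCommGroup F] [InnerProductSpace 𝕜 F] [NormedAddCommGroup G] [InnerProductSpace 𝕜 G]
  {ι κ : Type*} {p : ℝ}

theorem enorm_sq_rpow_half (x : E) : (‖x‖ₑ ^ 2) ^ (p / 2) = ‖x‖ₑ ^ p := by
  rw [← ENNReal.rpow_natCast, ← ENNReal.rpow_mul, Nat.cast_ofNat, mul_div_cancel₀ p two_ne_zero]

/-- `b` is a Hilbert basis of right singular vectors of `X`. The singular values of `X` are then
the norms `‖X (b i)‖`, which may vanish. -/
def IsSingularBasis (X : E →L[𝕜] F) (b : HilbertBasis ι 𝕜 E) : Prop :=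
  Pairwise fun i j => ⟪X (b i), X (b j)⟫_𝕜 = 0

theorem IsSingularBasis.smul {X : E →L[𝕜] F} {b : HilbertBasis ι 𝕜 E} (h : IsSingularBasis X b)
    (a : 𝕜) : IsSingularBasis (a • X) b := fun i j hij => by
  simp only [smul_apply, inner_smul_left, inner_smul_right, h hij, mul_zero]

/-- The column operator `x ↦ (A x, B x)` into the Hilbert sum of the codomains. -/
noncomputable def column (A : E →L[𝕜] F) (B : E →L[𝕜] G) : E →L[𝕜] WithLp 2 (F × G) :=
  (WithLp.prodContinuousLinearEquiv 2 𝕜 F G).symm.toContinuousLinearMap ∘L A.prod B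

theorem column_apply (A : E →L[𝕜] F) (B : E →L[𝕜] G) (x : E) :
    column A B x = WithLp.toLp 2 (A x, B x) := rfl

theorem enorm_column_sq (A : E →L[𝕜] F) (B : E →L[𝕜] G) (x : E) :
    ‖column A B x‖ₑ ^ 2 = ‖A x‖ₑ ^ 2 + ‖B x‖ₑ ^ 2 := by
  simp only [← ofReal_norm, ← ENNReal.ofReal_pow (norm_nonneg _), column_apply,
    WithLp.prod_norm_sq_eq_of_L2]
  exact ENNReal.ofReal_add (sq_nonneg _) (sq_nonneg _)

theorem enorm_sqrt_two_smul_column_sq (A B : E →L[𝕜] F) (x : E) :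
    ‖(((√2 : ℝ) : 𝕜) • column A B) x‖ₑ ^ 2 = ‖(A + B) x‖ₑ ^ 2 + ‖(A - B) x‖ₑ ^ 2 := by
  have hparallelogram := parallelogram_law_with_norm 𝕜 (A x) (B x)
  have hsqrt : ‖((√2 : ℝ) : 𝕜)‖ₑ ^ 2 = 2 := by
    rw [← ofReal_norm, ← ENNReal.ofReal_pow (norm_nonneg _)]
    simp
  rw [smul_apply, enorm_smul, mul_pow, hsqrt, enorm_column_sq]
  simp only [← ofReal_norm, ← ENNReal.ofReal_pow (norm_nonneg _), add_apply, sub_apply]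
  rw [← ENNReal.ofReal_add (by positivity) (by positivity),
    ← ENNReal.ofReal_add (by positivity) (by positivity), ← ENNReal.ofReal_ofNat,
    ← ENNReal.ofReal_mul zero_le_two]
  congr 1
  linarith

theorem isCompactOperator_column {A : E →L[𝕜] F} {B : E →L[𝕜] G} (hA : IsCompactOperator A)
    (hB : IsCompactOperator B) : IsCompactOperator (column A B) := by
  let L := (WithLp.prodContinuousLinearEquiv 2 𝕜 F G).symm.toContinuousLinearMap
  have hcolumn : ⇑(column A B) = ⇑(L ∘L .inl 𝕜 F G) ∘ ⇑A + ⇑(L ∘L .inr 𝕜 F G) ∘ ⇑B := by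
    ext1 x
    simp [column_apply, L, ← WithLp.toLp_add]
  rw [hcolumn]
  exact (hA.clm_comp _).add (hB.clm_comp _)

variable [CompleteSpace E] [CompleteSpace F] [CompleteSpace G]

theorem isCompactOperator_adjoint_comp {X : E →L[𝕜] F} (hX : IsCompactOperator X) :
    IsCompactOperator (X† ∘L X) :=
  hX.clm_comp (X†)

theorem isCompactOperator_adjoint_adjoint_comp {X : E →L[𝕜] F} (hX : IsCompactOperator X) :
    IsCompactOperator (X†† ∘L X†) := by
  rw [ContinuousLinearMap.adjoint_adjoint]
  exact hX.comp_clm (X†)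

theorem exists_isSingularBasis {X : E →L[𝕜] F} (hX : IsCompactOperator (X† ∘L X)) :
    ∃ (s : Set E) (b : HilbertBasis s 𝕜 E), IsSingularBasis X b := by
  obtain ⟨s, b, hb⟩ :=
    exists_hilbertBasis_mem_eigenspace hX X.isPositive_adjoint_comp_self.isSymmetric
  refine ⟨s, b, fun i j hij => ?_⟩
  obtain ⟨μ, hμ⟩ := hb j
  have hXb : (X†) (X (b j)) = μ • b j := End.mem_eigenspace_iff.1 hμ
  rw [← ContinuousLinearMap.adjoint_inner_right, hXb, inner_smul_right, b.orthonormal.2 hij,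
    mul_zero]

section SingularBasis

variable {X : E →L[𝕜] F} {b : HilbertBasis ι 𝕜 E}

theorem IsSingularBasis.adjoint_apply (h : IsSingularBasis X b) (i : ι) :
    (X†) (X (b i)) = (‖X (b i)‖ : 𝕜) ^ 2 • b i := by
  refine eq_of_forall_inner_hilbertBasis_eq b fun j => ?_
  rw [ContinuousLinearMap.adjoint_inner_right, inner_smul_right]
  obtain rfl | hij := eq_or_ne j i
  · simp [inner_self_eq_norm_sq_to_K, b.orthonormal.norm_eq_one]
  · rw [h hij, b.orthonormal.2 hij, mul_zero]

theorem IsSingularBasis.inner_adjoint_apply (h : IsSingularBasis X b) (i : ι) (x : E) :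
    ⟪b i, (X†) (X x)⟫_𝕜 = (‖X (b i)‖ : 𝕜) ^ 2 * ⟪b i, x⟫_𝕜 := by
  rw [ContinuousLinearMap.adjoint_inner_right, ← ContinuousLinearMap.adjoint_inner_left,
    h.adjoint_apply, inner_smul_left, map_pow, RCLike.conj_ofReal]

theorem IsSingularBasis.tsum_enorm_inner_sq_mul (h : IsSingularBasis X b) (x : E) :
    ∑' i, ‖⟪b i, x⟫_𝕜‖ₑ ^ 2 * ‖X (b i)‖ₑ ^ 2 = ‖X x‖ₑ ^ 2 := by
  have hsum : HasSum (fun i => ‖⟪b i, x⟫_𝕜‖ ^ 2 * ‖X (b i)‖ ^ 2) (‖X x‖ ^ 2) := by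
    have hre := RCLike.hasSum_re 𝕜 (b.hasSum_inner_mul_inner x ((X†) (X x)))
    rw [ContinuousLinearMap.adjoint_inner_right, inner_self_eq_norm_sq] at hre
    refine hre.congr_fun fun i => ?_
    rw [h.inner_adjoint_apply, mul_left_comm, ← RCLike.ofReal_pow, RCLike.re_ofReal_mul,
      inner_mul_symm_re_eq_norm, norm_mul, norm_inner_symm x]
    ring
  simp only [← ofReal_norm, ← ENNReal.ofReal_pow (norm_nonneg _), ← hsum.tsum_eq,
    ← ENNReal.ofReal_mul (sq_nonneg _)]
  exact (ENNReal.ofReal_tsum_of_nonneg (fun i => by positivity) hsum.summable).symm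

theorem IsSingularBasis.card_fiber_eq_finrank (h : IsSingularBasis X b)
    (hX : IsCompactOperator (X† ∘L X)) {s : ℝ≥0} (hs : s ≠ 0) :
    ENat.card {i // ‖X (b i)‖₊ = s} = finrank 𝕜
      (End.eigenspace ((X† ∘L X : E →L[𝕜] E) : E →ₗ[𝕜] E) (((s : ℝ) : 𝕜) ^ 2)) := by
  set V := End.eigenspace ((X† ∘L X : E →L[𝕜] E) : E →ₗ[𝕜] E) (((s : ℝ) : 𝕜) ^ 2) with hV
  have hs2 : ((s : ℝ) : 𝕜) ^ 2 ≠ 0 := by simpa using hs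
  have : FiniteDimensional 𝕜 V := ContinuousLinearMap.finite_dimensional_eigenspace hX _ hs2
  have hmem (i : {i // ‖X (b i)‖₊ = s}) : b i ∈ V := by
    have hs : ‖X (b i)‖ = s := congrArg ((↑) : ℝ≥0 → ℝ) i.2
    rw [hV, End.mem_eigenspace_iff, ← hs]
    exact h.adjoint_apply i
  let v (i : {i // ‖X (b i)‖₊ = s}) : V := ⟨b i, hmem i⟩
  have hv : Orthonormal 𝕜 v :=
    (b.orthonormal.comp _ Subtype.val_injective).codRestrict V hmem
  have hspan : (span 𝕜 (Set.range v))ᗮ = ⊥ := by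
    rw [eq_bot_iff]
    rintro ⟨x, hx⟩ hxv
    rw [mem_orthogonal] at hxv
    refine (mem_bot 𝕜).2 <| Subtype.ext <| eq_of_forall_inner_hilbertBasis_eq b fun i => ?_
    rw [ZeroMemClass.coe_zero, inner_zero_right]
    by_cases hi : ‖X (b i)‖₊ = s
    · exact hxv _ (subset_span ⟨⟨i, hi⟩, rfl⟩)
    · have hXx : (X†) (X x) = ((s : ℝ) : 𝕜) ^ 2 • x := End.mem_eigenspace_iff.1 hx
      have hinner := h.inner_adjoint_apply i x
      rw [hXx, inner_smul_right, mul_eq_mul_right_iff] at hinner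
      refine hinner.resolve_left fun hsq => hi ?_
      have hsq : (s : ℝ) ^ 2 = ‖X (b i)‖ ^ 2 := by exact_mod_cast hsq
      exact NNReal.eq ((sq_eq_sq₀ (norm_nonneg _) s.2).1 hsq.symm)
  have : Finite {i // ‖X (b i)‖₊ = s} := hv.linearIndependent.finite
  have := Fintype.ofFinite {i // ‖X (b i)‖₊ = s}
  rw [finrank_eq_card_basis (OrthonormalBasis.mkOfOrthogonalEqBot hv hspan).toBasis,
    ENat.card_eq_coe_fintype_card]

end SingularBasis

/-- The trace `tr |X| ^ p`, the sum of the `p`-th powers of the singular values of `X` with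
multiplicity, for `0 < p` and `X` with `X† X` compact. The term at `s = 0`, which stands for the
kernel of `X`, vanishes because `0 ^ p = 0`. -/
noncomputable def traceAbsRpow (p : ℝ) (X : E →L[𝕜] F) : ℝ≥0∞ :=
  ∑' s : ℝ≥0, finrank 𝕜 (End.eigenspace ((X† ∘L X : E →L[𝕜] E) : E →ₗ[𝕜] E)
    (((s : ℝ) : 𝕜) ^ 2)) * (s : ℝ≥0∞) ^ p

theorem traceAbsRpow_adjoint (hp : 0 < p) (X : E →L[𝕜] F) :
    traceAbsRpow p (X†) = traceAbsRpow p X := by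
  refine tsum_congr fun s => ?_
  obtain rfl | hs := eq_or_ne s 0
  · simp [hp]
  · have hs2 : ((s : ℝ) : 𝕜) ^ 2 ≠ 0 := by simpa using hs
    rw [ContinuousLinearMap.adjoint_adjoint, ContinuousLinearMap.toLinearMap_comp,
      finrank_eigenspace_comp_comm _ _ hs2, ContinuousLinearMap.toLinearMap_comp]

theorem IsSingularBasis.tsum_enorm_rpow {X : E →L[𝕜] F} {b : HilbertBasis ι 𝕜 E}
    (h : IsSingularBasis X b) (hX : IsCompactOperator (X† ∘L X)) (hp : 0 < p) :
    ∑' i, ‖X (b i)‖ₑ ^ p = traceAbsRpow p X := by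
  rw [← (Equiv.sigmaFiberEquiv fun i => ‖X (b i)‖₊).tsum_eq, ENNReal.tsum_sigma']
  refine tsum_congr fun s => ?_
  have hfiber (i : {i // ‖X (b i)‖₊ = s}) : ‖X (b i)‖ₑ = s := congrArg ((↑) : ℝ≥0 → ℝ≥0∞) i.2
  simp only [Equiv.sigmaFiberEquiv_apply, hfiber, ENNReal.tsum_const]
  obtain rfl | hs := eq_or_ne s 0
  · simp [hp]
  · simp [h.card_fiber_eq_finrank hX hs]

theorem traceAbsRpow_smul (hp : 0 < p) {X : E →L[𝕜] F} (hX : IsCompactOperator X) (a : 𝕜) :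
    traceAbsRpow p (a • X) = ‖a‖ₑ ^ p * traceAbsRpow p X := by
  have haX : IsCompactOperator (a • X) := hX.smul a
  obtain ⟨s, b, hb⟩ := exists_isSingularBasis (isCompactOperator_adjoint_comp hX)
  rw [← hb.tsum_enorm_rpow (isCompactOperator_adjoint_comp hX) hp,
    ← (hb.smul a).tsum_enorm_rpow (isCompactOperator_adjoint_comp haX) hp,
    ← ENNReal.tsum_mul_left]
  simp only [smul_apply, enorm_smul, ENNReal.mul_rpow_of_nonneg _ _ hp.le]

theorem tsum_enorm_rpow_le_traceAbsRpow (hp : 2 ≤ p) {X : E →L[𝕜] F}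
    (hX : IsCompactOperator (X† ∘L X)) (c : HilbertBasis κ 𝕜 E) :
    ∑' k, ‖X (c k)‖ₑ ^ p ≤ traceAbsRpow p X := by
  obtain ⟨s, b, hb⟩ := exists_isSingularBasis hX
  calc ∑' k, ‖X (c k)‖ₑ ^ p
      = ∑' k, (∑' i, ‖⟪b i, c k⟫_𝕜‖ₑ ^ 2 * ‖X (b i)‖ₑ ^ 2) ^ (p / 2) := by
        simp only [hb.tsum_enorm_inner_sq_mul, enorm_sq_rpow_half]
    _ ≤ ∑' k, ∑' i, ‖⟪b i, c k⟫_𝕜‖ₑ ^ 2 * (‖X (b i)‖ₑ ^ 2) ^ (p / 2) := by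
        gcongr with k
        exact rpow_tsum_mul_le_tsum_mul_rpow (by linarith)
          (tsum_enorm_inner_sq_hilbertBasis b c k).le _
    _ = ∑' i, ‖X (b i)‖ₑ ^ p := by
        simp only [tsum_tsum_enorm_inner_sq_mul, enorm_sq_rpow_half]
    _ = traceAbsRpow p X := hb.tsum_enorm_rpow hX (by linarith)

theorem traceAbsRpow_le_tsum_enorm_rpow (hp : 0 < p) (hp2 : p ≤ 2) {X : E →L[𝕜] F}
    (hX : IsCompactOperator (X† ∘L X)) (c : HilbertBasis κ 𝕜 E) :
    traceAbsRpow p X ≤ ∑' k, ‖X (c k)‖ₑ ^ p := by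
  obtain ⟨s, b, hb⟩ := exists_isSingularBasis hX
  calc traceAbsRpow p X
      = ∑' i, ‖X (b i)‖ₑ ^ p := (hb.tsum_enorm_rpow hX hp).symm
    _ = ∑' k, ∑' i, ‖⟪b i, c k⟫_𝕜‖ₑ ^ 2 * (‖X (b i)‖ₑ ^ 2) ^ (p / 2) := by
        simp only [tsum_tsum_enorm_inner_sq_mul, enorm_sq_rpow_half]
    _ ≤ ∑' k, (∑' i, ‖⟪b i, c k⟫_𝕜‖ₑ ^ 2 * ‖X (b i)‖ₑ ^ 2) ^ (p / 2) := by
        gcongr with k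
        exact tsum_mul_rpow_le_rpow_tsum_mul (by linarith) (by linarith)
          (tsum_enorm_inner_sq_hilbertBasis b c k).le _
    _ = ∑' k, ‖X (c k)‖ₑ ^ p := by
        simp only [hb.tsum_enorm_inner_sq_mul, enorm_sq_rpow_half]

section SumOfSquares

variable {F' : Type*} [NormedAddCommGroup F'] [InnerProductSpace 𝕜 F'] [CompleteSpace F']
  {X : E →L[𝕜] F'} {A : E →L[𝕜] F} {B : E →L[𝕜] G}

theorem traceAbsRpow_le_of_enorm_sq_eq_add (hp : 2 ≤ p) (hX : IsCompactOperator (X† ∘L X))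
    (hA : IsCompactOperator (A† ∘L A)) (hB : IsCompactOperator (B† ∘L B))
    (h : ∀ x, ‖X x‖ₑ ^ 2 = ‖A x‖ₑ ^ 2 + ‖B x‖ₑ ^ 2) :
    traceAbsRpow p X ≤ 2 ^ (p / 2 - 1) * (traceAbsRpow p A + traceAbsRpow p B) := by
  obtain ⟨s, c, hc⟩ := exists_isSingularBasis hX
  calc traceAbsRpow p X
      = ∑' k, (‖A (c k)‖ₑ ^ 2 + ‖B (c k)‖ₑ ^ 2) ^ (p / 2) := by
        simp only [← h, enorm_sq_rpow_half, hc.tsum_enorm_rpow hX (by linarith)]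
    _ ≤ ∑' k, 2 ^ (p / 2 - 1) * ((‖A (c k)‖ₑ ^ 2) ^ (p / 2) + (‖B (c k)‖ₑ ^ 2) ^ (p / 2)) := by
        gcongr with k
        exact ENNReal.rpow_add_le_mul_rpow_add_rpow _ _ (by linarith)
    _ = 2 ^ (p / 2 - 1) * (∑' k, ‖A (c k)‖ₑ ^ p + ∑' k, ‖B (c k)‖ₑ ^ p) := by
        simp only [enorm_sq_rpow_half, ENNReal.tsum_mul_left, ENNReal.tsum_add]
    _ ≤ 2 ^ (p / 2 - 1) * (traceAbsRpow p A + traceAbsRpow p B) := by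
        gcongr
        · exact tsum_enorm_rpow_le_traceAbsRpow hp hA c
        · exact tsum_enorm_rpow_le_traceAbsRpow hp hB c

theorem traceAbsRpow_add_le_of_enorm_sq_eq_add (hp : 0 < p) (hp2 : p ≤ 2)
    (hX : IsCompactOperator (X† ∘L X)) (hA : IsCompactOperator (A† ∘L A))
    (hB : IsCompactOperator (B† ∘L B)) (h : ∀ x, ‖X x‖ₑ ^ 2 = ‖A x‖ₑ ^ 2 + ‖B x‖ₑ ^ 2) :
    traceAbsRpow p A + traceAbsRpow p B ≤ 2 ^ (1 - p / 2) * traceAbsRpow p X := by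
  obtain ⟨s, c, hc⟩ := exists_isSingularBasis hX
  calc traceAbsRpow p A + traceAbsRpow p B
      ≤ ∑' k, ‖A (c k)‖ₑ ^ p + ∑' k, ‖B (c k)‖ₑ ^ p := by
        gcongr
        · exact traceAbsRpow_le_tsum_enorm_rpow hp hp2 hA c
        · exact traceAbsRpow_le_tsum_enorm_rpow hp hp2 hB c
    _ = ∑' k, ((‖A (c k)‖ₑ ^ 2) ^ (p / 2) + (‖B (c k)‖ₑ ^ 2) ^ (p / 2)) := by
        simp only [enorm_sq_rpow_half, ENNReal.tsum_add]
    _ ≤ ∑' k, 2 ^ (1 - p / 2) * (‖A (c k)‖ₑ ^ 2 + ‖B (c k)‖ₑ ^ 2) ^ (p / 2) := by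
        gcongr with k
        exact rpow_add_rpow_le_two_rpow_mul_add_rpow (by linarith) (by linarith) _ _
    _ = 2 ^ (1 - p / 2) * traceAbsRpow p X := by
        simp only [← h, enorm_sq_rpow_half, ENNReal.tsum_mul_left, hc.tsum_enorm_rpow hX hp]

end SumOfSquares

section Column

variable {A : E →L[𝕜] F} {B : E →L[𝕜] G}

theorem adjoint_column_apply (y : F) (z : G) :
    ((column A B)†) (WithLp.toLp 2 (y, z)) = (A†) y + (B†) z :=
  ext_inner_right 𝕜 fun x => by
    simp only [ContinuousLinearMap.adjoint_inner_left, column_apply, WithLp.prod_inner_apply,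
      inner_add_left]

theorem exists_tsum_enorm_adjoint_column_rpow_eq (hp : 0 < p) (hA : IsCompactOperator A)
    (hB : IsCompactOperator B) :
    ∃ (s : Set F) (t : Set G) (c : HilbertBasis (s ⊕ t) 𝕜 (WithLp 2 (F × G))),
      ∑' k, ‖((column A B)†) (c k)‖ₑ ^ p = traceAbsRpow p A + traceAbsRpow p B := by
  have hA' := isCompactOperator_adjoint_adjoint_comp hA
  have hB' := isCompactOperator_adjoint_adjoint_comp hB
  obtain ⟨_, e, he⟩ := exists_isSingularBasis hA'
  obtain ⟨_, f, hf⟩ := exists_isSingularBasis hB'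
  obtain ⟨c, hce, hcf⟩ := exists_hilbertBasis_prod e f
  refine ⟨_, _, c, ?_⟩
  rw [← traceAbsRpow_adjoint hp A, ← traceAbsRpow_adjoint hp B, ← he.tsum_enorm_rpow hA' hp,
    ← hf.tsum_enorm_rpow hB' hp, ENNReal.summable.tsum_sum ENNReal.summable]
  simp only [hce, hcf, adjoint_column_apply, map_zero, add_zero, zero_add]

theorem traceAbsRpow_add_le_traceAbsRpow_column (hp : 2 ≤ p) (hA : IsCompactOperator A)
    (hB : IsCompactOperator B) :
    traceAbsRpow p A + traceAbsRpow p B ≤ traceAbsRpow p (column A B) := by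
  have hp0 : 0 < p := by linarith
  obtain ⟨_, _, c, hc⟩ := exists_tsum_enorm_adjoint_column_rpow_eq hp0 hA hB
  rw [← hc, ← traceAbsRpow_adjoint hp0]
  exact tsum_enorm_rpow_le_traceAbsRpow hp
    (isCompactOperator_adjoint_adjoint_comp (isCompactOperator_column hA hB)) c

theorem traceAbsRpow_column_le_add (hp : 0 < p) (hp2 : p ≤ 2) (hA : IsCompactOperator A)
    (hB : IsCompactOperator B) :
    traceAbsRpow p (column A B) ≤ traceAbsRpow p A + traceAbsRpow p B := by
  obtain ⟨_, _, c, hc⟩ := exists_tsum_enorm_adjoint_column_rpow_eq hp hA hB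
  rw [← hc, ← traceAbsRpow_adjoint hp]
  exact traceAbsRpow_le_tsum_enorm_rpow hp hp2
    (isCompactOperator_adjoint_adjoint_comp (isCompactOperator_column hA hB)) c

end Column

section ClarksonMcCarthy

theorem two_rpow_mul_traceAbsRpow_sqrt_two_smul (hp : 0 < p) {X : E →L[𝕜] F}
    (hX : IsCompactOperator X) :
    2 ^ (1 - p / 2) * traceAbsRpow p (((√2 : ℝ) : 𝕜) • X) = 2 * traceAbsRpow p X := by
  have hsqrt : ‖((√2 : ℝ) : 𝕜)‖ₑ ^ p = 2 ^ (p / 2) := by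
    rw [← ofReal_norm, RCLike.norm_ofReal, abs_of_nonneg (Real.sqrt_nonneg 2), Real.sqrt_eq_rpow,
      ← ENNReal.ofReal_rpow_of_pos two_pos, ← ENNReal.rpow_mul, ENNReal.ofReal_ofNat,
      one_div_mul_eq_div]
  rw [traceAbsRpow_smul hp hX, hsqrt, ← mul_assoc,
    ← ENNReal.rpow_add _ _ two_ne_zero ENNReal.ofNat_ne_top, sub_add_cancel, ENNReal.rpow_one]

variable {A B : E →L[𝕜] F}

theorem two_mul_traceAbsRpow_add_le (hp : 2 ≤ p) (hA : IsCompactOperator A)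
    (hB : IsCompactOperator B) :
    2 * (traceAbsRpow p A + traceAbsRpow p B) ≤
      traceAbsRpow p (A + B) + traceAbsRpow p (A - B) := by
  have hcolumn := isCompactOperator_column hA hB
  have hsmul : IsCompactOperator (((√2 : ℝ) : 𝕜) • column A B) := hcolumn.smul ((√2 : ℝ) : 𝕜)
  calc 2 * (traceAbsRpow p A + traceAbsRpow p B)
      ≤ 2 * traceAbsRpow p (column A B) := by
        gcongr
        exact traceAbsRpow_add_le_traceAbsRpow_column hp hA hB
    _ = 2 ^ (1 - p / 2) * traceAbsRpow p (((√2 : ℝ) : 𝕜) • column A B) :=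
        (two_rpow_mul_traceAbsRpow_sqrt_two_smul (by linarith) hcolumn).symm
    _ ≤ 2 ^ (1 - p / 2) *
          (2 ^ (p / 2 - 1) * (traceAbsRpow p (A + B) + traceAbsRpow p (A - B))) := by
        gcongr
        exact traceAbsRpow_le_of_enorm_sq_eq_add hp (isCompactOperator_adjoint_comp hsmul)
          (isCompactOperator_adjoint_comp (hA.add hB)) (isCompactOperator_adjoint_comp (hA.sub hB))
          (enorm_sqrt_two_smul_column_sq A B)
    _ = traceAbsRpow p (A + B) + traceAbsRpow p (A - B) := by
        rw [← mul_assoc, ← ENNReal.rpow_add _ _ two_ne_zero ENNReal.ofNat_ne_top,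
          sub_add_sub_cancel, sub_self, ENNReal.rpow_zero, one_mul]

theorem traceAbsRpow_add_add_traceAbsRpow_sub_le (hp : 0 < p) (hp2 : p ≤ 2)
    (hA : IsCompactOperator A) (hB : IsCompactOperator B) :
    traceAbsRpow p (A + B) + traceAbsRpow p (A - B) ≤
      2 * (traceAbsRpow p A + traceAbsRpow p B) := by
  have hcolumn := isCompactOperator_column hA hB
  have hsmul : IsCompactOperator (((√2 : ℝ) : 𝕜) • column A B) := hcolumn.smul ((√2 : ℝ) : 𝕜)
  calc traceAbsRpow p (A + B) + traceAbsRpow p (A - B)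
      ≤ 2 ^ (1 - p / 2) * traceAbsRpow p (((√2 : ℝ) : 𝕜) • column A B) :=
        traceAbsRpow_add_le_of_enorm_sq_eq_add hp hp2 (isCompactOperator_adjoint_comp hsmul)
          (isCompactOperator_adjoint_comp (hA.add hB)) (isCompactOperator_adjoint_comp (hA.sub hB))
          (enorm_sqrt_two_smul_column_sq A B)
    _ = 2 * traceAbsRpow p (column A B) := two_rpow_mul_traceAbsRpow_sqrt_two_smul hp hcolumn
    _ ≤ 2 * (traceAbsRpow p A + traceAbsRpow p B) := by
        gcongr
        exact traceAbsRpow_column_le_add hp hp2 hA hB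

theorem traceAbsRpow_add_add_traceAbsRpow_sub_ne_top (hp : 0 < p) (hA : IsCompactOperator A)
    (hB : IsCompactOperator B) (hfA : traceAbsRpow p A ≠ ∞) (hfB : traceAbsRpow p B ≠ ∞) :
    traceAbsRpow p (A + B) + traceAbsRpow p (A - B) ≠ ∞ := by
  have hfAB : traceAbsRpow p A + traceAbsRpow p B ≠ ∞ := ENNReal.add_ne_top.2 ⟨hfA, hfB⟩
  obtain hp2 | hp2 := le_total p 2
  · exact ne_top_of_le_ne_top (ENNReal.mul_ne_top ENNReal.ofNat_ne_top hfAB)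
      (traceAbsRpow_add_add_traceAbsRpow_sub_le hp hp2 hA hB)
  · have h := two_mul_traceAbsRpow_add_le hp2 (A := A + B) (B := A - B) (hA.add hB) (hA.sub hB)
    have hadd : A + B + (A - B) = (2 : 𝕜) • A := by rw [two_smul]; abel
    have hsub : A + B - (A - B) = (2 : 𝕜) • B := by rw [two_smul]; abel
    rw [hadd, hsub, traceAbsRpow_smul hp hA, traceAbsRpow_smul hp hB, ← mul_add] at h
    have htop := ne_top_of_le_ne_top (ENNReal.mul_ne_top (by finiteness) hfAB) h
    rw [two_mul, ENNReal.add_ne_top] at htop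
    exact htop.1

end ClarksonMcCarthy

section SchattenNorm

variable {H : Type*} [NormedAddCommGroup H] [InnerProductSpace ℂ H] [CompleteSpace H]
  {X A B : H →L[ℂ] H}

theorem singularValue_rpow_nonneg (p : ℝ) (X : H →L[ℂ] H) (j : Index X) :
    0 ≤ singularValue X j ^ p :=
  Real.rpow_nonneg (le_of_lt j.1.2) p

theorem tsum_ofReal_singularValue_rpow (hp : 0 < p) (X : H →L[ℂ] H) :
    ∑' j : Index X, ENNReal.ofReal (singularValue X j ^ p) = traceAbsRpow p X := by
  let incl (s : Set.Ioi (0 : ℝ)) : ℝ≥0 := ⟨s, le_of_lt s.2⟩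
  have hincl : Function.Injective incl := fun s t h => Subtype.ext (congrArg NNReal.toReal h)
  rw [ENNReal.tsum_sigma', traceAbsRpow, ← hincl.tsum_eq]
  · refine tsum_congr fun s => ?_
    have hrpow : ENNReal.ofReal ((s : ℝ) ^ p) = (incl s : ℝ≥0∞) ^ p := by
      rw [← ENNReal.ofReal_rpow_of_pos s.2, ENNReal.ofReal_eq_coe_nnreal (le_of_lt s.2)]
      rfl
    simp only [singularValue, hrpow, ENNReal.tsum_const, ENat.card_eq_coe_fintype_card,
      Fintype.card_fin, ENat.toENNReal_coe]
    rfl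
  · intro s hs
    have hs0 : s ≠ 0 := by
      rintro rfl
      simp [hp] at hs
    exact ⟨⟨s, pos_iff_ne_zero.2 hs0⟩, rfl⟩

theorem mem_iff (hp : 0 < p) : Mem p X ↔ IsCompactOperator X ∧ traceAbsRpow p X ≠ ∞ := by
  refine and_congr_right fun _ => ?_
  rw [← tsum_ofReal_singularValue_rpow hp]
  exact ⟨fun h => h.tsum_ofReal_ne_top, fun h => by
    simpa [singularValue_rpow_nonneg] using ENNReal.summable_toReal h⟩

theorem schattenNorm_nonneg (p : ℝ) (X : H →L[ℂ] H) : 0 ≤ schattenNorm p X :=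
  Real.rpow_nonneg (tsum_nonneg (singularValue_rpow_nonneg p X)) _

theorem schattenNorm_rpow (hp : 0 < p) (X : H →L[ℂ] H) :
    schattenNorm p X ^ p = (traceAbsRpow p X).toReal := by
  have hnonneg : 0 ≤ ∑' j, singularValue X j ^ p := tsum_nonneg (singularValue_rpow_nonneg p X)
  rw [schattenNorm, one_div, Real.rpow_inv_rpow hnonneg hp.ne', ← tsum_ofReal_singularValue_rpow hp,
    ENNReal.tsum_toReal_eq fun _ => ENNReal.ofReal_ne_top]
  simp only [ENNReal.toReal_ofReal (singularValue_rpow_nonneg p X _)]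

theorem Mem.add_and_sub (hp : 0 < p) (hA : Mem p A) (hB : Mem p B) :
    Mem p (A + B) ∧ Mem p (A - B) := by
  rw [mem_iff hp] at hA hB
  have h := traceAbsRpow_add_add_traceAbsRpow_sub_ne_top hp hA.1 hB.1 hA.2 hB.2
  rw [ENNReal.add_ne_top] at h
  exact ⟨(mem_iff hp).2 ⟨hA.1.add hB.1, h.1⟩, (mem_iff hp).2 ⟨hA.1.sub hB.1, h.2⟩⟩

theorem Mem.two_mul_schattenNorm_rpow_add_le (hp : 2 ≤ p) (hA : Mem p A) (hB : Mem p B) :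
    2 * (schattenNorm p A ^ p + schattenNorm p B ^ p) ≤
      schattenNorm p (A + B) ^ p + schattenNorm p (A - B) ^ p := by
  have hp0 : 0 < p := by linarith
  obtain ⟨hadd, hsub⟩ := hA.add_and_sub hp0 hB
  rw [mem_iff hp0] at hA hB hadd hsub
  have h := ENNReal.toReal_mono (ENNReal.add_ne_top.2 ⟨hadd.2, hsub.2⟩)
    (two_mul_traceAbsRpow_add_le hp hA.1 hB.1)
  simpa only [schattenNorm_rpow hp0, ENNReal.toReal_mul, ENNReal.toReal_ofNat,
    ENNReal.toReal_add hA.2 hB.2, ENNReal.toReal_add hadd.2 hsub.2] using h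

theorem Mem.schattenNorm_add_rpow_add_schattenNorm_sub_rpow_le (hp : 0 < p) (hp2 : p ≤ 2)
    (hA : Mem p A) (hB : Mem p B) :
    schattenNorm p (A + B) ^ p + schattenNorm p (A - B) ^ p ≤
      2 * (schattenNorm p A ^ p + schattenNorm p B ^ p) := by
  obtain ⟨hadd, hsub⟩ := hA.add_and_sub hp hB
  rw [mem_iff hp] at hA hB hadd hsub
  have h := ENNReal.toReal_mono
    (ENNReal.mul_ne_top ENNReal.ofNat_ne_top (ENNReal.add_ne_top.2 ⟨hA.2, hB.2⟩))
    (traceAbsRpow_add_add_traceAbsRpow_sub_le hp hp2 hA.1 hB.1)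
  simpa only [schattenNorm_rpow hp, ENNReal.toReal_mul, ENNReal.toReal_ofNat,
    ENNReal.toReal_add hA.2 hB.2, ENNReal.toReal_add hadd.2 hsub.2] using h

end SchattenNorm

end Schatten

theorem theorem1p11 {H : Type*} [NormedAddCommGroup H] [InnerProductSpace ℂ H] [CompleteSpace H]
    (p : ℝ) (hp : 0 < p) (A B : H →L[ℂ] H)
    (hA : Schatten.Mem p A) (hB : Schatten.Mem p B) :
    Schatten.Mem p (A + B) ∧ Schatten.Mem p (A - B) ∧
    (2 ≤ p →
      (2 : ℝ) ^ (2 - p / 2) *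
          (Schatten.schattenNorm p A ^ 2 + Schatten.schattenNorm p B ^ 2) ^ (p / 2) ≤
        Schatten.schattenNorm p (A + B) ^ p + Schatten.schattenNorm p (A - B) ^ p ∧
      (2 : ℝ) ^ (2 / p - 1) *
          (Schatten.schattenNorm p A ^ 2 + Schatten.schattenNorm p B ^ 2) ≤
        ((Schatten.schattenNorm p (A + B) ^ p + Schatten.schattenNorm p (A - B) ^ p) / 2)
          ^ (2 / p)) ∧
    (p ≤ 2 →
      Schatten.schattenNorm p (A + B) ^ p + Schatten.schattenNorm p (A - B) ^ p ≤
        (2 : ℝ) ^ (2 - p / 2) *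
          (Schatten.schattenNorm p A ^ 2 + Schatten.schattenNorm p B ^ 2) ^ (p / 2) ∧
      ((Schatten.schattenNorm p (A + B) ^ p + Schatten.schattenNorm p (A - B) ^ p) / 2)
          ^ (2 / p) ≤
        (2 : ℝ) ^ (2 / p - 1) *
          (Schatten.schattenNorm p A ^ 2 + Schatten.schattenNorm p B ^ 2)) := by
  have hA0 := Schatten.schattenNorm_nonneg p A
  have hB0 := Schatten.schattenNorm_nonneg p B
  have hadd0 := Real.rpow_nonneg (Schatten.schattenNorm_nonneg p (A + B)) p
  have hsub0 := Real.rpow_nonneg (Schatten.schattenNorm_nonneg p (A - B)) p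
  obtain ⟨hadd, hsub⟩ := hA.add_and_sub hp hB
  rw [two_rpow_mul_eq_rpow hp (by positivity)]
  refine ⟨hadd, hsub, fun hp2 => ?_, fun hp2 => ?_⟩
  · have h := (two_rpow_mul_add_sq_rpow_le hp2 hA0 hB0).trans
      (hA.two_mul_schattenNorm_rpow_add_le hp2 hB)
    exact ⟨h, by gcongr⟩
  · have h := (hA.schattenNorm_add_rpow_add_schattenNorm_sub_rpow_le hp hp2 hB).trans
      (two_mul_rpow_add_rpow_le hp hp2 hA0 hB0)
    exact ⟨h, by gcongr⟩
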